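/- **Theorem (Mean Value Theorem for the massive Dirac equation).** Let $n\ge 0$ and let $\mathcal{C}$ be the Clifford algebra, over $\mathbb{R}$ or over $\mathbb{C}$, with generators $e_1,\dots,e_n$ satisfying $e_ie_j+e_je_i=-2\delta_{ij}$. Let $M:\mathcal{C}\to\mathcal{C}$ be a bounded real-linear operator commuting with left multiplication by every $e_j$; for example $M=M_\lambda$, $M_\lambda a=a\lambda$, the right multiplication by a Clifford number $\lambda$. Let $\Omega\subseteq\mathbb{R}^{n+1}$ be open, with coordinates $y=(y_0,y_1,\dots,y_n)$, and let $f$ be a $\mathcal{C}$-valued function which is continuous on $\overline{\Omega}$, differentiable in $\Omega$, and satisfies $$\frac{\partial f}{\partial y_0}=\Big(\sum_{j=1}^n e_j\frac{\partial}{\partial y_j}+M\Big)f\qquad\text{in }\Omega .$$ Then for every $x\in\Omega$ and $R>0$ such that the open ball $B(x,R)$ is contained in $\Omega$, the function $y\mapsto e^{-y_0M}f(y)$ is integrable over $B(x,R)$ and $$f(x)=e^{x_0M}\,\frac{(n+1)\,\Gamma\!\left(\frac{n+1}{2}\right)}{2R^{n+1}\pi^{(n+1)/2}}\int_{B(x,R)}e^{-y_0M}f(y)\,dy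 .$$ Here $e^{tM}=\sum_{k\ge0}t^kM^k/k!$ and $dy$ is Lebesgue measure. -/

import Mathlib

noncomputable section

namespace MassiveDirac

/-- The quadratic form `v ↦ -∑ j, v j ^ 2` on `𝕜ⁿ`, for `𝕜 = ℝ` or `𝕜 = ℂ`. -/
def negSumSq (𝕜 : Type*) [RCLike 𝕜] (n : ℕ) : QuadraticForm 𝕜 (Fin n → 𝕜) :=
  QuadraticMap.weightedSumSquares 𝕜 (fun _ : Fin n => (-1 : 𝕜))

/-- The Clifford algebra over `𝕜` with generators `e 0, …, e (n - 1)` subject to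
`e i * e j + e j * e i = -2 δ i j`. -/
abbrev Cl (𝕜 : Type*) [RCLike 𝕜] (n : ℕ) : Type _ := CliffordAlgebra (negSumSq 𝕜 n)

/-- The standard generators of the Clifford algebra. -/
def e (𝕜 : Type*) [RCLike 𝕜] {n : ℕ} (j : Fin n) : Cl 𝕜 n :=
  CliffordAlgebra.ι (negSumSq 𝕜 n) (Pi.single j 1)

theorem e_mul_e_add (𝕜 : Type*) [RCLike 𝕜] {n : ℕ} (i j : Fin n) :
    e 𝕜 i * e 𝕜 j + e 𝕜 j * e 𝕜 i = algebraMap 𝕜 (Cl 𝕜 n) (if i = j then -2 else 0) := by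
  unfold e
  rw [CliffordAlgebra.ι_mul_ι_add_swap]
  congr 1
  simp only [QuadraticMap.polar, negSumSq, QuadraticMap.weightedSumSquares_apply, smul_eq_mul,
    ← Finset.sum_sub_distrib, Pi.add_apply]
  rw [Finset.sum_eq_single i]
  · split_ifs with h
    · subst h
      simp only [Pi.single_eq_same]
      ring
    · simp [h]
  · intro k _ hk
    simp [hk]
  · simp

/-- The coordinates of a Clifford number with respect to the standard basis
`e_A = e_{i₁} ⋯ e_{iₖ}`, `A = {i₁ < ⋯ < iₖ}`. (The identification with the exterior algebra sends
the product of distinct generators, which are pairwise orthogonal, to their wedge product.) -/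
def coords (𝕜 : Type*) [RCLike 𝕜] (n : ℕ) :
    Cl 𝕜 n ≃ₗ[𝕜] EuclideanSpace 𝕜 (Finset (Fin n)) :=
  letI : Invertible (2 : 𝕜) := invertibleOfNonzero two_ne_zero
  ((CliffordAlgebra.equivExterior (negSumSq 𝕜 n)).trans
    (Pi.basisFun 𝕜 (Fin n)).ExteriorAlgebra.equivFun).trans (WithLp.linearEquiv 2 𝕜 _).symm

/-- The usual Euclidean norm `|a|² = ∑_A |a_A|²` of a Clifford number `a = ∑_A a_A e_A`. -/
instance (𝕜 : Type*) [RCLike 𝕜] (n : ℕ) : NormedAddCommGroup (Cl 𝕜 n) :=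
  NormedAddCommGroup.induced (Cl 𝕜 n) (EuclideanSpace 𝕜 (Finset (Fin n))) (coords 𝕜 n)
    (coords 𝕜 n).injective

theorem norm_def (𝕜 : Type*) [RCLike 𝕜] (n : ℕ) (a : Cl 𝕜 n) : ‖a‖ = ‖coords 𝕜 n a‖ := rfl

instance (𝕜 : Type*) [RCLike 𝕜] (n : ℕ) : NormedSpace ℝ (Cl 𝕜 n) where
  norm_smul_le r a := by
    have h : r • a = (algebraMap ℝ 𝕜 r) • a := (algebraMap_smul 𝕜 r a).symm
    rw [norm_def, norm_def, h, map_smul, norm_smul, norm_algebraMap']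

/-- `IsSolution M Ω f`: the function `f`, with values in the Clifford algebra, is continuous on the
closure of `Ω`, and in `Ω` it is differentiable and solves the Dirac equation with mass term `M`,
`∂f/∂y₀ = ∑_{j=1}^n e_j ∂f/∂y_j + M f`.
The generator `e_j` and the coordinate `y_j`, `1 ≤ j ≤ n`, are `e 𝕜 i` and `y i.succ` for the
`i : Fin n` with `j = i + 1`. -/
structure IsSolution {𝕜 : Type*} [RCLike 𝕜] {n : ℕ} (M : Cl 𝕜 n →L[ℝ] Cl 𝕜 n)
    (Ω : Set (EuclideanSpace ℝ (Fin (n + 1)))) (f : EuclideanSpace ℝ (Fin (n + 1)) → Cl 𝕜 n) :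
    Prop where
  continuousOn_closure : ContinuousOn f (closure Ω)
  differentiableAt : ∀ y ∈ Ω, DifferentiableAt ℝ f y
  dirac_eq : ∀ y ∈ Ω,
    fderiv ℝ f y (EuclideanSpace.single 0 1) =
      ∑ j : Fin n, e 𝕜 j * fderiv ℝ f y (EuclideanSpace.single j.succ 1) + M (f y)

end MassiveDirac

end

open MeasureTheory Metric Set Filter Topology

namespace MassiveDirac

/-! ### Mean value property for first-order systems in a Banach space -/

section MeanValue

variable {E : Type*} [NormedAddCommGroup E] [NormedSpace ℝ E]

/-! Commuting with `M` and every `e_j`, the factor `e^{-y₀M}` absorbs the mass: `g = e^{-y₀M} f`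
solves `∑ C_i ∂_i g = 0` with `C_0 = 1`, `C_j = -e_j`. It remains to prove the mean value property
for `g` at the centre, translated to 0.

With `B_0 = 1`, `B_j = e_j` one has `B_i C_j + B_j C_i = 2δ_ij`, and nothing else about Clifford
numbers is used. Put `T(y) = ∑ y_i B_i`. The field `X_i = h(‖y‖²) T(y) C_i g` has divergence `((n+1)
h + 2‖y‖² h') g`, so this integrates to 0 for suitable cutoffs `h`
(`integral_radial_kernel_smul_eq_zero`). Up to a factor `c^n`, that integral with `h(s) = φ(c²s)` is
the derivative of `G(c) = ∫ c^(n+1) φ(c²‖y‖²) g`. Hence `G(1)` equals the limit at `c → ∞`, where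
the kernel concentrates at 0: `integral_radial_smul_eq`. Letting `φ(‖y‖²)` increase to the full ball
gives `setIntegral_ball_zero_eq`. No Cauchy kernel or surface integral over spheres is needed. -/

/-- The integral of the divergence of a differentiable compactly supported vector field vanishes. -/
theorem integral_divergence_eq_zero {n : ℕ}
    (X : Fin (n + 1) → EuclideanSpace ℝ (Fin (n + 1)) → E)
    (X' : Fin (n + 1) → EuclideanSpace ℝ (Fin (n + 1)) → EuclideanSpace ℝ (Fin (n + 1)) →L[ℝ] E)
    (hX : ∀ i y, HasFDerivAt (X i) (X' i y) y) {ρ : ℝ} (hρ : 0 < ρ)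
    (h0 : ∀ i y, ρ ≤ ‖y‖ → X i y = 0)
    (hint : Integrable fun y => ∑ i, X' i y (EuclideanSpace.single i 1)) :
    ∫ y, ∑ i, X' i y (EuclideanSpace.single i 1) = 0 := by
  have hX'0 : ∀ i y, ρ < ‖y‖ → X' i y = 0 := by
    intro i y hy
    have : X i =ᶠ[𝓝 y] fun _ => 0 := by
      filter_upwards [(isOpen_lt continuous_const continuous_norm).mem_nhds hy] with z hz
      exact h0 i z (le_of_lt hz)
    exact (hX i y).unique ((hasFDerivAt_const (0 : E) y).congr_of_eventuallyEq this)
  have hcoord : ∀ (z : Fin (n + 1) → ℝ) i, |z i| ≤ ‖WithLp.toLp 2 z‖ := fun z i => by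
    simpa using PiLp.norm_apply_le (WithLp.toLp 2 z) i
  have hvol := PiLp.volume_preserving_toLp (Fin (n + 1))
  have hemb := (MeasurableEquiv.toLp 2 (Fin (n + 1) → ℝ)).measurableEmbedding
  rw [← hvol.integral_comp hemb]
  have hint' : Integrable (fun z : Fin (n + 1) → ℝ =>
      ∑ i, X' i (WithLp.toLp 2 z) (EuclideanSpace.single i 1)) :=
    (hvol.integrable_comp_emb hemb).2 hint
  rw [← setIntegral_eq_integral_of_forall_compl_eq_zero
    (s := Icc (fun _ => -ρ) (fun _ => ρ)) ?_]
  · have key := integral_divergence_of_hasFDerivAt_off_countable'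
      (fun _ : Fin (n + 1) => -ρ) (fun _ => ρ) (fun _ => by simp only []; linarith)
      (fun i z => X i (WithLp.toLp 2 z))
      (fun i z => (X' i (WithLp.toLp 2 z)).comp
        ((EuclideanSpace.equiv (Fin (n + 1)) ℝ).symm : (Fin (n + 1) → ℝ) →L[ℝ] _))
      ∅ countable_empty ?_ ?_ ?_
    · refine Eq.trans ?_ (key.trans (Finset.sum_eq_zero fun i _ => ?_))
      · rfl
      -- Points on the faces of the cube `[-ρ, ρ]^(n+1)` have Euclidean norm at least `ρ`, so every
      -- boundary term vanishes.
      · have h1 : ∀ z : Fin n → ℝ, X i (WithLp.toLp 2 (i.insertNth ρ z)) = 0 := fun z =>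
          h0 i _ (by
            have := hcoord (i.insertNth ρ z) i
            rw [Fin.insertNth_apply_same] at this
            exact (le_abs_self ρ).trans this)
        have h2 : ∀ z : Fin n → ℝ, X i (WithLp.toLp 2 (i.insertNth (-ρ) z)) = 0 := fun z =>
          h0 i _ (by
            have := hcoord (i.insertNth (-ρ) z) i
            rw [Fin.insertNth_apply_same, abs_neg] at this
            exact (le_abs_self ρ).trans this)
        simp [h1, h2]
    · intro i
      have : Continuous (X i) := continuous_iff_continuousAt.2 fun y => (hX i y).continuousAt
      exact (this.comp (PiLp.continuous_toLp 2 _)).continuousOn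
    · intro z _ i
      exact (hX i _).comp z ((EuclideanSpace.equiv (Fin (n + 1)) ℝ).symm.hasFDerivAt)
    · exact hint'.integrableOn
  · intro z hz
    have : ∃ i, ρ < |z i| := by
      by_contra! hcon
      exact hz ⟨fun i => (abs_le.1 (hcon i)).1, fun i => (abs_le.1 (hcon i)).2⟩
    obtain ⟨i, hi⟩ := this
    exact Finset.sum_eq_zero fun j _ => by
      rw [hX'0 j _ (hi.trans_le (hcoord z i))]; rfl

theorem integrable_smul_of_continuousOn_closedBall {n : ℕ}
    {K : EuclideanSpace ℝ (Fin n) → ℝ} (hK : Continuous K)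
    {g : EuclideanSpace ℝ (Fin n) → E} {ρ : ℝ} (hg : ContinuousOn g (closedBall 0 ρ))
    (h0 : ∀ y, ρ < ‖y‖ → K y = 0) : Integrable fun y => K y • g y := by
  refine IntegrableOn.integrable_of_forall_notMem_eq_zero (s := closedBall 0 ρ)
    ((hK.continuousOn.smul hg).integrableOn_compact (isCompact_closedBall 0 ρ)) fun y hy => ?_
  rw [h0 y (by simpa using hy), zero_smul]

theorem hasDerivAt_eq_zero_of_eq_zero_of_le {h : ℝ → ℝ} {d a s : ℝ} (hh : HasDerivAt h d s)
    (h0 : ∀ t, a ≤ t → h t = 0) (hs : a < s) : d = 0 := by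
  have : h =ᶠ[𝓝 s] fun _ => 0 := by
    filter_upwards [Ioi_mem_nhds hs] with z hz using h0 z (le_of_lt hz)
  exact hh.unique ((hasDerivAt_const s (0 : ℝ)).congr_of_eventuallyEq this)

variable {n : ℕ} {B C : Fin (n + 1) → E →L[ℝ] E}

/-- Stokes' theorem for `∑ i, C i ∂ᵢ g = 0`, tested against the radial field
`h (‖y‖²) ∑ i, y i B i`. -/
theorem integral_radial_kernel_smul_eq_zero
    (hBC : ∀ i j v, B i (C j v) + B j (C i v) = if i = j then (2 : ℝ) • v else 0)
    {R ρ : ℝ} (hρ : 0 < ρ) (hρR : ρ < R) {g : EuclideanSpace ℝ (Fin (n + 1)) → E}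
    (hg : ∀ y ∈ ball 0 R, DifferentiableAt ℝ g y)
    (hD : ∀ y ∈ ball 0 R, ∑ i, C i (fderiv ℝ g y (EuclideanSpace.single i 1)) = 0)
    {h h' : ℝ → ℝ} (hh : ∀ s, HasDerivAt h (h' s) s) (hh' : Continuous h')
    (h0 : ∀ s, ρ ^ 2 ≤ s → h s = 0) :
    ∫ y, (2 * ‖y‖ ^ 2 * h' (‖y‖ ^ 2) + (n + 1) * h (‖y‖ ^ 2)) • g y = 0 := by
  let T : EuclideanSpace ℝ (Fin (n + 1)) →L[ℝ] E →L[ℝ] E :=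
    ∑ i, (EuclideanSpace.proj i : _ →L[ℝ] ℝ).smulRight (B i)
  have hT : ∀ (y : EuclideanSpace ℝ (Fin (n + 1))) (v : E), T y v = ∑ i, y i • B i v := fun y v => by simp [T]
  have hTs : ∀ i v, T (EuclideanSpace.single i 1) v = B i v := fun i v => by
    simp [hT, ite_smul]
  have hBC1 : ∀ i v, B i (C i v) = v := fun i v => by
    have h2 := hBC i i v
    rw [if_pos rfl, ← two_smul ℝ] at h2
    exact smul_right_injective E (two_ne_zero (α := ℝ)) h2
  -- Symmetrising the double sum over `y_i y_j` brings in the relation `hBC`, of which only the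
  -- diagonal survives.
  have hTC : ∀ (y : EuclideanSpace ℝ (Fin (n + 1))) (v : E), ∑ i, y i • T y (C i v) = ‖y‖ ^ 2 • v := by
    intro y v
    have e1 : ∑ i, y i • T y (C i v) = ∑ i, ∑ j, (y i * y j) • B j (C i v) := by
      simp [hT, Finset.smul_sum, smul_smul]
    have e2 : ∑ i, y i • T y (C i v) = ∑ i, ∑ j, (y i * y j) • B i (C j v) := by
      rw [e1, Finset.sum_comm]
      simp [mul_comm]
    have e3 : (2 : ℝ) • ∑ i, y i • T y (C i v) = (2 : ℝ) • (‖y‖ ^ 2 • v) := by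
      rw [two_smul]
      nth_rewrite 1 [e2]
      rw [e1, ← Finset.sum_add_distrib]
      simp_rw [← Finset.sum_add_distrib, ← smul_add, hBC]
      simp only [smul_ite, smul_zero, Finset.sum_ite_eq, Finset.mem_univ, if_true]
      rw [EuclideanSpace.real_norm_sq_eq, Finset.sum_smul, Finset.smul_sum]
      refine Finset.sum_congr rfl fun i _ => ?_
      rw [smul_smul, smul_smul]
      ring_nf
    exact smul_right_injective E (two_ne_zero (α := ℝ)) e3
  have hh'0 : ∀ s, ρ ^ 2 < s → h' s = 0 := fun s hs =>
    hasDerivAt_eq_zero_of_eq_zero_of_le (hh s) h0 hs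
  have hhc : Continuous h := continuous_iff_continuousAt.2 fun s => (hh s).continuousAt
  let X : Fin (n + 1) → EuclideanSpace ℝ (Fin (n + 1)) → E := fun i y =>
    h (‖y‖ ^ 2) • T y (C i (g y))
  have hX0 : ∀ i y, ρ ≤ ‖y‖ → X i y = 0 := fun i y hy => by
    simp only [X]
    rw [h0 _ (by gcongr), zero_smul]
  have hout : ∀ (i) (y : EuclideanSpace ℝ (Fin (n + 1))), y ∉ ball 0 R →
      HasFDerivAt (X i) (0 : _ →L[ℝ] E) y := by
    intro i y hy
    have hy' : ρ < ‖y‖ := by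
      rw [mem_ball_zero_iff, not_lt] at hy
      exact hρR.trans_le hy
    have : X i =ᶠ[𝓝 y] fun _ => 0 := by
      filter_upwards [(isOpen_lt continuous_const continuous_norm).mem_nhds hy'] with z hz
      exact hX0 i z (le_of_lt hz)
    exact (hasFDerivAt_const (0 : E) y).congr_of_eventuallyEq this
  have hin : ∀ i y, y ∈ ball 0 R → HasFDerivAt (X i)
      (h (‖y‖ ^ 2) • ((T y).comp ((C i).comp (fderiv ℝ g y)) + T.flip (C i (g y))) +
        (h' (‖y‖ ^ 2) • ((2 : ℝ) • innerSL ℝ y)).smulRight (T y (C i (g y)))) y := by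
    intro i y hy
    have d1 : HasFDerivAt (fun y : EuclideanSpace ℝ (Fin (n + 1)) => h (‖y‖ ^ 2))
        (h' (‖y‖ ^ 2) • ((2 : ℝ) • innerSL ℝ y)) y := by
      have := (hasStrictFDerivAt_norm_sq y).hasFDerivAt
      rw [two_smul] at this ⊢
      exact (hh (‖y‖ ^ 2)).comp_hasFDerivAt y this
    have d2 : HasFDerivAt (fun y => T y (C i (g y)))
        ((T y).comp ((C i).comp (fderiv ℝ g y)) + T.flip (C i (g y))) y :=
      T.hasFDerivAt.clm_apply ((C i).hasFDerivAt.comp y (hg y hy).hasFDerivAt)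
    exact d1.smul d2
  -- Although `g` is differentiable only in the ball, the cutoff makes each `X i` differentiable
  -- everywhere.
  have hdiff : ∀ i y, HasFDerivAt (X i) (fderiv ℝ (X i) y) y := fun i y => by
    by_cases hy : y ∈ ball 0 R
    · exact (hin i y hy).differentiableAt.hasFDerivAt
    · exact (hout i y hy).differentiableAt.hasFDerivAt
  have hdiv : ∀ y, ∑ i, fderiv ℝ (X i) y (EuclideanSpace.single i 1) =
      (2 * ‖y‖ ^ 2 * h' (‖y‖ ^ 2) + (n + 1) * h (‖y‖ ^ 2)) • g y := by
    intro y
    by_cases hy : y ∈ ball 0 R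
    · simp_rw [fun i => (hin i y hy).fderiv]
      simp only [add_apply, smul_apply,
        ContinuousLinearMap.comp_apply, ContinuousLinearMap.flip_apply,
        ContinuousLinearMap.smulRight_apply, hTs, hBC1, innerSL_apply_apply,
        EuclideanSpace.inner_single_right]
      rw [Finset.sum_add_distrib, ← Finset.smul_sum, Finset.sum_add_distrib, ← map_sum, hD y hy]
      simp only [smul_eq_mul, mul_smul, ← Finset.smul_sum, map_zero, zero_add, Finset.sum_const,
        Finset.card_univ, Fintype.card_fin, one_smul, conj_trivial, hTC]
      rw [← Nat.cast_smul_eq_nsmul ℝ]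
      simp only [smul_smul, ← add_smul]
      push_cast
      ring_nf
    · have hy' : ρ < ‖y‖ := by
        rw [mem_ball_zero_iff, not_lt] at hy
        exact hρR.trans_le hy
      have hy2 : ρ ^ 2 < ‖y‖ ^ 2 := by gcongr
      simp [fun i => (hout i y hy).fderiv, h0 _ hy2.le, hh'0 _ hy2]
  have hgc : ContinuousOn g (closedBall 0 ρ) := fun y hy =>
    (hg y (closedBall_subset_ball hρR hy)).continuousAt.continuousWithinAt
  -- The equation has removed the derivatives of `g` from the divergence, so continuity of `g` gives
  -- integrability and no `C¹` hypothesis is needed.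
  have hint := integrable_smul_of_continuousOn_closedBall (K := fun y =>
    2 * ‖y‖ ^ 2 * h' (‖y‖ ^ 2) + (n + 1) * h (‖y‖ ^ 2)) (by fun_prop) hgc (fun y hy => by
      have hy2 : ρ ^ 2 < ‖y‖ ^ 2 := by gcongr
      simp [h0 _ hy2.le, hh'0 _ hy2])
  simp_rw [← hdiv] at hint ⊢
  exact integral_divergence_eq_zero X _ hdiff hρ hX0 hint

theorem hasDerivAt_integral_rescaled_radial {m : ℕ} {ρ : ℝ}
    {g : EuclideanSpace ℝ (Fin m) → E} (hg : ContinuousOn g (closedBall 0 ρ))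
    {φ φ' : ℝ → ℝ} (hφ : ∀ s, HasDerivAt φ (φ' s) s) (hφ' : Continuous φ') (c : ℝ) :
    HasDerivAt
      (fun c : ℝ => ∫ y in closedBall 0 ρ, (c ^ (n + 1) * φ (c ^ 2 * ‖y‖ ^ 2)) • g y)
      (∫ y in closedBall 0 ρ, ((n + 1) * c ^ n * φ (c ^ 2 * ‖y‖ ^ 2) +
        c ^ (n + 1) * (φ' (c ^ 2 * ‖y‖ ^ 2) * (2 * c * ‖y‖ ^ 2))) • g y) c := by
  have hφc : Continuous φ := continuous_iff_continuousAt.2 fun s => (hφ s).continuousAt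
  have hint : ∀ K : EuclideanSpace ℝ (Fin m) → ℝ, Continuous K →
      Integrable (fun y => K y • g y) (volume.restrict (closedBall 0 ρ)) := fun K hK =>
    (hK.continuousOn.smul hg).integrableOn_compact (isCompact_closedBall 0 ρ)
  let k : ℝ × EuclideanSpace ℝ (Fin m) → ℝ := fun p =>
    (n + 1) * p.1 ^ n * φ (p.1 ^ 2 * ‖p.2‖ ^ 2) +
      p.1 ^ (n + 1) * (φ' (p.1 ^ 2 * ‖p.2‖ ^ 2) * (2 * p.1 * ‖p.2‖ ^ 2))
  have hk : Continuous k := by fun_prop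
  obtain ⟨A, hA⟩ := ((isCompact_Icc (a := c - 1) (b := c + 1)).prod
    (isCompact_closedBall (0 : EuclideanSpace ℝ (Fin m)) ρ)).exists_bound_of_continuousOn
      hk.continuousOn
  refine (hasDerivAt_integral_of_dominated_loc_of_deriv_le
    (s := Icc (c - 1) (c + 1)) (bound := fun y => A * ‖g y‖)
    (F' := fun c y => k (c, y) • g y) (Icc_mem_nhds (by linarith) (by linarith))
    (Eventually.of_forall fun c => (hint _ (by fun_prop)).aestronglyMeasurable)
    (hint _ (by fun_prop)) (hint _ (by fun_prop)).aestronglyMeasurable ?_ ?_ ?_).2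
  · refine (ae_restrict_iff' measurableSet_closedBall).2 (Eventually.of_forall ?_)
    intro y hy c' hc'
    rw [norm_smul]
    exact mul_le_mul_of_nonneg_right (hA (c', y) ⟨hc', hy⟩) (norm_nonneg _)
  · exact (hg.norm.integrableOn_compact (isCompact_closedBall 0 ρ)).const_mul A
  · refine Eventually.of_forall fun y c' _ => HasDerivAt.smul_const ?_ _
    have h1 : HasDerivAt (fun c : ℝ => c ^ 2 * ‖y‖ ^ 2) (2 * c' * ‖y‖ ^ 2) c' := by
      simpa using (hasDerivAt_pow 2 c').mul_const (‖y‖ ^ 2)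
    have h2 := (hasDerivAt_pow (n + 1) c').mul ((hφ _).comp c' h1)
    refine h2.congr_deriv ?_
    simp [k]

/-- Rescaling a radial kernel to concentrate at the origin does not change its integral against `g`,
so the approximate-identity limit gives the value. -/
theorem integral_radial_smul_eq [CompleteSpace E]
    (hBC : ∀ i j v, B i (C j v) + B j (C i v) = if i = j then (2 : ℝ) • v else 0)
    {R ρ : ℝ} (hρ : 0 < ρ) (hρR : ρ < R) {g : EuclideanSpace ℝ (Fin (n + 1)) → E}
    (hg : ∀ y ∈ ball 0 R, DifferentiableAt ℝ g y)
    (hD : ∀ y ∈ ball 0 R, ∑ i, C i (fderiv ℝ g y (EuclideanSpace.single i 1)) = 0)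
    {φ φ' : ℝ → ℝ} (hφ : ∀ s, HasDerivAt φ (φ' s) s) (hφ' : Continuous φ')
    (hpos : ∀ s, 0 ≤ φ s) (h0 : ∀ s, ρ ^ 2 ≤ s → φ s = 0) :
    ∫ y, φ (‖y‖ ^ 2) • g y = (∫ y : EuclideanSpace ℝ (Fin (n + 1)), φ (‖y‖ ^ 2)) • g 0 := by
  have hφc : Continuous φ := continuous_iff_continuousAt.2 fun s => (hφ s).continuousAt
  have h0n : ∀ y : EuclideanSpace ℝ (Fin (n + 1)), ρ < ‖y‖ → φ (‖y‖ ^ 2) = 0 := fun y hy =>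
    h0 _ (by gcongr)
  have hφint : Integrable fun y : EuclideanSpace ℝ (Fin (n + 1)) => φ (‖y‖ ^ 2) := by
    simpa using integrable_smul_of_continuousOn_closedBall
      (K := fun y : EuclideanSpace ℝ (Fin (n + 1)) => φ (‖y‖ ^ 2)) (by fun_prop)
      (continuousOn_const (c := (1 : ℝ))) h0n
  set I := ∫ y : EuclideanSpace ℝ (Fin (n + 1)), φ (‖y‖ ^ 2) with hI
  rcases eq_or_ne I 0 with hI0 | hI0
  -- The kernel cannot be normalised here, but being nonnegative it vanishes almost everywhere.
  · rw [hI0, zero_smul]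
    have := (integral_eq_zero_iff_of_nonneg (fun y => hpos _) hφint).1 hI0
    refine integral_eq_zero_of_ae ?_
    filter_upwards [this] with y hy
    simp only [Pi.zero_apply] at hy
    simp [hy]
  obtain ⟨σ, hρσ, hσR⟩ := exists_between hρR
  have hgc : ContinuousOn g (closedBall 0 σ) := fun y hy =>
    (hg y (closedBall_subset_ball hσR hy)).continuousAt.continuousWithinAt
  let G : ℝ → E := fun c =>
    ∫ y in closedBall 0 σ, (c ^ (n + 1) * φ (c ^ 2 * ‖y‖ ^ 2)) • g y
  -- For `c ≥ 1` the rescaled kernel vanishes beyond radius `ρ / c ≤ ρ < R`, so it stays inside the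
  -- region where the equation holds.
  have hG : ∀ c, 1 ≤ c → HasDerivAt G 0 c := by
    intro c hc
    have hc0 : 0 < c := by linarith
    have hle : ∀ s, (ρ / c) ^ 2 ≤ s → ρ ^ 2 ≤ c ^ 2 * s := fun s hs => by
      rwa [div_pow, div_le_iff₀' (by positivity)] at hs
    have key := integral_radial_kernel_smul_eq_zero hBC (div_pos hρ hc0)
      ((div_le_self hρ.le hc).trans_lt hρR) hg hD (h := fun s => φ (c ^ 2 * s))
      (h' := fun s => c ^ 2 * φ' (c ^ 2 * s))
      (fun s => by
        have h1 : HasDerivAt (fun s : ℝ => c ^ 2 * s) (c ^ 2) s := by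
          simpa using (hasDerivAt_id s).const_mul (c ^ 2)
        exact ((hφ _).comp s h1).congr_deriv (mul_comm _ _))
      (by fun_prop) (fun s hs => h0 _ (hle s hs))
    refine (hasDerivAt_integral_rescaled_radial hgc hφ hφ' c).congr_deriv ?_
    rw [setIntegral_eq_integral_of_forall_compl_eq_zero]
    · refine Eq.trans ?_ ((congrArg (fun v : E => c ^ n • v) key).trans (smul_zero _))
      rw [← integral_smul]
      refine integral_congr_ae (Eventually.of_forall fun y => ?_)
      simp only [smul_smul]
      ring_nf
    · intro y hy
      have hy' : ρ < ‖y‖ := by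
        rw [mem_closedBall_zero_iff, not_le] at hy
        exact hρσ.trans hy
      have hlt : ρ ^ 2 < c ^ 2 * ‖y‖ ^ 2 := by
        rw [← mul_pow]
        have : ‖y‖ ≤ c * ‖y‖ := le_mul_of_one_le_left (norm_nonneg y) hc
        gcongr
        linarith
      simp [h0 _ hlt.le, hasDerivAt_eq_zero_of_eq_zero_of_le (hφ _) h0 hlt]
  have hconst : ∀ c, 1 ≤ c → G c = G 1 := fun c hc =>
    constant_of_has_deriv_right_zero (a := 1) (b := c)
      (fun t ht => (hG t ht.1).continuousAt.continuousWithinAt)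
      (fun t ht => (hG t ht.1).hasDerivWithinAt) c ⟨hc, le_rfl⟩
  have hG1 : G 1 = ∫ y, φ (‖y‖ ^ 2) • g y := by
    simp only [G, one_pow, one_mul]
    refine setIntegral_eq_integral_of_forall_compl_eq_zero fun y hy => ?_
    rw [mem_closedBall_zero_iff, not_le] at hy
    rw [h0n y (hρσ.trans hy), zero_smul]
  have hlim := tendsto_integral_comp_smul_smul_of_integrable (μ := volume)
    (φ := fun y : EuclideanSpace ℝ (Fin (n + 1)) => I⁻¹ * φ (‖y‖ ^ 2))
    (g := (closedBall 0 σ).indicator g)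
    (fun y => mul_nonneg (inv_nonneg.2 (integral_nonneg fun y => hpos _)) (hpos _))
    (by rw [integral_const_mul, ← hI, inv_mul_cancel₀ hI0])
    (by
      refine tendsto_const_nhds.congr' ?_
      filter_upwards [(hasBasis_cobounded_norm (E := EuclideanSpace ℝ (Fin (n + 1)))).mem_of_mem
        (i := ρ) trivial] with y hy
      have hy : ρ ≤ ‖y‖ := hy
      rw [h0 _ (by gcongr)]
      simp)
    ((integrable_indicator_iff measurableSet_closedBall).2
      (hgc.integrableOn_compact (isCompact_closedBall 0 σ)))
    (by
      have hmem : ball (0 : EuclideanSpace ℝ (Fin (n + 1))) σ ∈ 𝓝 0 :=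
        ball_mem_nhds _ (hρ.trans hρσ)
      refine (hg 0 (mem_ball_self (hρ.trans hρR))).continuousAt.congr ?_
      filter_upwards [hmem] with y hy
      rw [indicator_of_mem (ball_subset_closedBall hy)])
  rw [indicator_of_mem (mem_closedBall_self (hρ.trans hρσ).le)] at hlim
  have hev : ∀ᶠ c : ℝ in atTop, I⁻¹ • G 1 =
      ∫ y, (c ^ Module.finrank ℝ (EuclideanSpace ℝ (Fin (n + 1))) *
        (I⁻¹ * φ (‖c • y‖ ^ 2))) • (closedBall 0 σ).indicator g y := by
    filter_upwards [eventually_ge_atTop 1] with c hc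
    rw [← hconst c hc, ← integral_smul, ← integral_indicator measurableSet_closedBall]
    refine integral_congr_ae (Eventually.of_forall fun y => ?_)
    by_cases hy : y ∈ closedBall (0 : EuclideanSpace ℝ (Fin (n + 1))) σ
    · simp only [indicator_of_mem hy, smul_smul, finrank_euclideanSpace_fin, norm_smul, mul_pow,
        Real.norm_eq_abs, sq_abs]
      ring_nf
    · simp [indicator_of_notMem hy]
  have := tendsto_nhds_unique (tendsto_const_nhds.congr' hev) hlim
  rw [← hG1, ← this, smul_inv_smul₀ hI0]

theorem tendsto_integral_radial_cutoff_smul {m : ℕ} {R : ℝ} (hR : 0 < R) {φ : ℕ → ℝ → ℝ}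
    (hφ : ∀ k, Continuous (φ k)) (hpos : ∀ k s, 0 ≤ φ k s) (hle : ∀ k s, φ k s ≤ 1)
    (h0 : ∀ k s, R ^ 2 ≤ s → φ k s = 0) (h1 : ∀ s, s < R ^ 2 → ∀ᶠ k in atTop, φ k s = 1)
    {u : EuclideanSpace ℝ (Fin m) → E} (hu : IntegrableOn u (ball 0 R)) :
    Tendsto (fun k => ∫ y, φ k (‖y‖ ^ 2) • u y) atTop (𝓝 (∫ y in ball 0 R, u y)) := by
  have heq : ∀ k, ∫ y, φ k (‖y‖ ^ 2) • u y = ∫ y in ball 0 R, φ k (‖y‖ ^ 2) • u y := by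
    intro k
    refine (setIntegral_eq_integral_of_forall_compl_eq_zero fun y hy => ?_).symm
    rw [mem_ball_zero_iff, not_lt] at hy
    rw [h0 k _ (by gcongr), zero_smul]
  simp_rw [heq]
  refine tendsto_integral_of_dominated_convergence (fun y => ‖u y‖) (fun k => ?_) hu.norm
    (fun k => Eventually.of_forall fun y => ?_) ?_
  · have : Continuous fun y : EuclideanSpace ℝ (Fin m) => φ k (‖y‖ ^ 2) :=
      (hφ k).comp (by fun_prop)
    exact this.aestronglyMeasurable.smul hu.aestronglyMeasurable
  · rw [norm_smul, Real.norm_of_nonneg (hpos _ _)]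
    exact mul_le_of_le_one_left (norm_nonneg _) (hle _ _)
  · refine (ae_restrict_iff' measurableSet_ball).2 (Eventually.of_forall fun y hy => ?_)
    rw [mem_ball_zero_iff] at hy
    refine tendsto_const_nhds.congr' ?_
    filter_upwards [h1 (‖y‖ ^ 2) (by gcongr)] with k hk
    rw [hk, one_smul]

theorem setIntegral_ball_zero_eq [CompleteSpace E]
    (hBC : ∀ i j v, B i (C j v) + B j (C i v) = if i = j then (2 : ℝ) • v else 0)
    {R : ℝ} (hR : 0 < R) {g : EuclideanSpace ℝ (Fin (n + 1)) → E}
    (hint : IntegrableOn g (ball 0 R))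
    (hg : ∀ y ∈ ball 0 R, DifferentiableAt ℝ g y)
    (hD : ∀ y ∈ ball 0 R, ∑ i, C i (fderiv ℝ g y (EuclideanSpace.single i 1)) = 0) :
    ∫ y in ball 0 R, g y = volume.real (ball (0 : EuclideanSpace ℝ (Fin (n + 1))) R) • g 0 := by
  -- The shift to `(k+1)/(k+2)` keeps `ρ k` positive at `k = 0`. The factor `k` in `φ` steepens the
  -- transition, so `φ k s` is eventually 1 for each `s < R²`.
  let ρ : ℕ → ℝ := fun k => R * (((k + 1 : ℕ) : ℝ) / ((k + 1 : ℕ) + 1))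
  let φ : ℕ → ℝ → ℝ := fun k s => Real.smoothTransition (k * (ρ k ^ 2 - s))
  have hρ : ∀ k, 0 < ρ k := fun k => by positivity
  have hρR : ∀ k, ρ k < R := fun k => by
    refine mul_lt_of_lt_one_right hR ?_
    rw [div_lt_one (by positivity)]
    linarith
  have hρlim : Tendsto ρ atTop (𝓝 R) := by
    have h1 := (tendsto_natCast_div_add_atTop (1 : ℝ)).comp (tendsto_add_atTop_nat 1)
    rw [← mul_one R]
    exact h1.const_mul R
  have hφd : ∀ k, ContDiff ℝ 1 (φ k) := fun k =>
    Real.smoothTransition.contDiff.comp (by fun_prop)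
  have hφ0 : ∀ k s, ρ k ^ 2 ≤ s → φ k s = 0 := fun k s hs =>
    Real.smoothTransition.zero_of_nonpos
      (mul_nonpos_of_nonneg_of_nonpos k.cast_nonneg (by linarith))
  have hφ1 : ∀ s, s < R ^ 2 → ∀ᶠ k in atTop, φ k s = 1 := by
    intro s hs
    have h1 : Tendsto (fun k : ℕ => (k : ℝ) * (ρ k ^ 2 - s)) atTop atTop :=
      tendsto_natCast_atTop_atTop.atTop_mul_pos (sub_pos.2 hs) ((hρlim.pow 2).sub_const _)
    filter_upwards [h1.eventually_ge_atTop 1] with k hk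
    exact Real.smoothTransition.one_of_one_le hk
  have hφR : ∀ k s, R ^ 2 ≤ s → φ k s = 0 := fun k s hs =>
    hφ0 k s (le_trans (by have := hρ k; have := (hρR k).le; gcongr) hs)
  have h1 := tendsto_integral_radial_cutoff_smul hR
    (fun k => (hφd k).continuous) (fun _ _ => Real.smoothTransition.nonneg _)
    (fun _ _ => Real.smoothTransition.le_one _) hφR hφ1 hint
  have h2 := tendsto_integral_radial_cutoff_smul hR
    (fun k => (hφd k).continuous) (fun _ _ => Real.smoothTransition.nonneg _)
    (fun _ _ => Real.smoothTransition.le_one _) hφR hφ1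
    (u := fun _ : EuclideanSpace ℝ (Fin (n + 1)) => (1 : ℝ))
    (integrableOn_const measure_ball_lt_top.ne)
  simp only [smul_eq_mul, mul_one, setIntegral_const] at h2
  refine tendsto_nhds_unique h1 ((h2.smul_const (g 0)).congr fun k => ?_)
  exact (integral_radial_smul_eq hBC (hρ k) (hρR k) hg hD
    (fun s => ((hφd k).differentiable one_ne_zero s).hasDerivAt)
    ((hφd k).continuous_deriv le_rfl) (fun s => Real.smoothTransition.nonneg _) (hφ0 k)).symm

end MeanValue

/-! ### Clifford operators and removal of the mass term -/

instance finiteDimensional_real_cl (𝕜 : Type*) [RCLike 𝕜] (n : ℕ) :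
    FiniteDimensional ℝ (Cl 𝕜 n) :=
  have : Module.Finite 𝕜 (Cl 𝕜 n) := Module.Finite.equiv (coords 𝕜 n).symm
  Module.Finite.trans 𝕜 (Cl 𝕜 n)

/-- Left multiplication by the generator `e j`, as a bounded real-linear operator. -/
noncomputable def leftMulE (𝕜 : Type*) [RCLike 𝕜] {n : ℕ} (j : Fin n) :
    Cl 𝕜 n →L[ℝ] Cl 𝕜 n :=
  LinearMap.toContinuousLinearMap (LinearMap.mulLeft ℝ (e 𝕜 j))

variable {𝕜 : Type*} [RCLike 𝕜] {n : ℕ}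

@[simp]
theorem leftMulE_apply (j : Fin n) (a : Cl 𝕜 n) : leftMulE 𝕜 j a = e 𝕜 j * a := rfl

theorem leftMulE_anticomm (i j : Fin n) (a : Cl 𝕜 n) :
    leftMulE 𝕜 i (leftMulE 𝕜 j a) + leftMulE 𝕜 j (leftMulE 𝕜 i a) =
      if i = j then (-2 : ℝ) • a else 0 := by
  simp only [leftMulE_apply, ← mul_assoc, ← add_mul, e_mul_e_add]
  split_ifs
  · have h2 : algebraMap ℝ 𝕜 (-2) = -2 := by rw [map_neg, map_ofNat]
    rw [← Algebra.smul_def, ← algebraMap_smul 𝕜 (-2 : ℝ) a, h2]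
  · simp

theorem paravector_operators_anticomm (i j : Fin (n + 1)) (a : Cl 𝕜 n) :
    (Fin.cons (ContinuousLinearMap.id ℝ (Cl 𝕜 n)) (leftMulE 𝕜) : Fin (n + 1) → _) i
        ((Fin.cons (ContinuousLinearMap.id ℝ (Cl 𝕜 n)) (fun j => -leftMulE 𝕜 j) :
          Fin (n + 1) → _) j a) +
      (Fin.cons (ContinuousLinearMap.id ℝ (Cl 𝕜 n)) (leftMulE 𝕜) : Fin (n + 1) → _) j
        ((Fin.cons (ContinuousLinearMap.id ℝ (Cl 𝕜 n)) (fun j => -leftMulE 𝕜 j) :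
          Fin (n + 1) → _) i a) = if i = j then (2 : ℝ) • a else 0 := by
  refine Fin.cases ?_ (fun i => ?_) i <;> refine Fin.cases ?_ (fun j => ?_) j
  · simp [two_smul]
  · simp [(Fin.succ_ne_zero j).symm]
  · simp [Fin.succ_ne_zero i]
  · have := congrArg Neg.neg (leftMulE_anticomm i j a)
    simp only [Fin.cons_succ, neg_apply, map_neg, Fin.succ_inj]
    rw [← neg_add, this]
    split_ifs <;> simp

theorem hasFDerivAt_exp_smul_apply {E : Type*} [NormedAddCommGroup E] [NormedSpace ℝ E]
    [CompleteSpace E] (M : E →L[ℝ] E) {f : EuclideanSpace ℝ (Fin (n + 1)) → E}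
    (x y : EuclideanSpace ℝ (Fin (n + 1))) (hf : DifferentiableAt ℝ f (y + x)) :
    HasFDerivAt (fun y => NormedSpace.exp ((-((y + x) 0)) • M) (f (y + x)))
      ((NormedSpace.exp ((-((y + x) 0)) • M)).comp (fderiv ℝ f (y + x)) -
        (EuclideanSpace.proj 0 : EuclideanSpace ℝ (Fin (n + 1)) →L[ℝ] ℝ).smulRight
          (M (NormedSpace.exp ((-((y + x) 0)) • M) (f (y + x))))) y := by
  have h1 : HasFDerivAt (fun y : EuclideanSpace ℝ (Fin (n + 1)) => -((y + x) 0))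
      (-(EuclideanSpace.proj 0 : EuclideanSpace ℝ (Fin (n + 1)) →L[ℝ] ℝ)) y :=
    (((EuclideanSpace.proj 0 : EuclideanSpace ℝ (Fin (n + 1)) →L[ℝ] ℝ).hasFDerivAt).comp y
      ((hasFDerivAt_id y).add_const x)).neg
  have h2 := (hasDerivAt_exp_smul_const' M (-((y + x) 0))).hasFDerivAt.comp y h1
  have h3 : HasFDerivAt (fun y => f (y + x)) (fderiv ℝ f (y + x)) y :=
    hf.hasFDerivAt.comp y ((hasFDerivAt_id y).add_const x)
  refine (h2.clm_apply h3).congr_fderiv ?_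
  ext v
  simp [sub_eq_add_neg]

/-- Differentiating the exponential in `y₀` produces exactly `-M`, cancelling the mass term; the
exponential then passes through each `e_j` because `M` does. -/
theorem dirac_exp_smul_apply_eq_zero {M : Cl 𝕜 n →L[ℝ] Cl 𝕜 n}
    (hM : ∀ (j : Fin n) (a : Cl 𝕜 n), M (e 𝕜 j * a) = e 𝕜 j * M a)
    {Ω : Set (EuclideanSpace ℝ (Fin (n + 1)))} {f : EuclideanSpace ℝ (Fin (n + 1)) → Cl 𝕜 n}
    (hf : IsSolution M Ω f) (x y : EuclideanSpace ℝ (Fin (n + 1))) (hy : y + x ∈ Ω) :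
    ∑ i, (Fin.cons (ContinuousLinearMap.id ℝ (Cl 𝕜 n)) (fun j => -leftMulE 𝕜 j) :
      Fin (n + 1) → Cl 𝕜 n →L[ℝ] Cl 𝕜 n) i
        (fderiv ℝ (fun y => NormedSpace.exp ((-((y + x) 0)) • M) (f (y + x))) y
          (EuclideanSpace.single i 1)) = 0 := by
  rw [(hasFDerivAt_exp_smul_apply M x y (hf.differentiableAt _ hy)).fderiv]
  set P := NormedSpace.exp ((-((y + x) 0)) • M) with hP
  have hPM : ∀ a, P (M a) = M (P a) := fun a => by
    have : Commute P M := (((Commute.refl M).smul_left _).exp_left)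
    exact DFunLike.congr_fun this.eq a
  have hPe : ∀ j a, P (e 𝕜 j * a) = e 𝕜 j * P a := fun j a => by
    have h1 : Commute M (leftMulE 𝕜 j) := ContinuousLinearMap.ext fun a => hM j a
    have : Commute P (leftMulE 𝕜 j) := ((h1.smul_left _).exp_left)
    exact DFunLike.congr_fun this.eq a
  rw [Fin.sum_univ_succ]
  simp [hf.dirac_eq _ hy, hPM, hPe, Finset.sum_neg_distrib, Fin.succ_ne_zero]

/-- The stated constant is the reciprocal volume of the ball, by `Γ(s + 1) = s Γ(s)` at `s =
(n+1)/2`. -/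
theorem volume_real_ball_inv (x : EuclideanSpace ℝ (Fin (n + 1))) {R : ℝ} (hR : 0 < R) :
    ((n : ℝ) + 1) * Real.Gamma (((n : ℝ) + 1) / 2) /
      (2 * R ^ (n + 1) * Real.pi ^ (((n : ℝ) + 1) / 2)) = (volume.real (ball x R))⁻¹ := by
  rw [Measure.real, EuclideanSpace.volume_ball]
  have hpi : √Real.pi ^ (n + 1) = Real.pi ^ (((n : ℝ) + 1) / 2) := by
    rw [Real.sqrt_eq_rpow, ← Real.rpow_natCast, ← Real.rpow_mul Real.pi_pos.le]
    push_cast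
    ring_nf
  have hG := Real.Gamma_add_one (s := ((n : ℝ) + 1) / 2) (by positivity)
  have hGpos : 0 < Real.Gamma (((n : ℝ) + 1) / 2) := Real.Gamma_pos_of_pos (by positivity)
  have hpipos : 0 < Real.pi ^ (((n : ℝ) + 1) / 2) := Real.rpow_pos_of_pos Real.pi_pos _
  rw [Fintype.card_fin, hpi]
  push_cast
  rw [hG, ENNReal.toReal_mul, ENNReal.toReal_pow, ENNReal.toReal_ofReal hR.le,
    ENNReal.toReal_ofReal (by positivity)]
  field_simp

end MassiveDirac

/-! ### The mean value theorem -/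

theorem mainTheorem6 {𝕜 : Type*} [RCLike 𝕜] {n : ℕ}
    (M : MassiveDirac.Cl 𝕜 n →L[ℝ] MassiveDirac.Cl 𝕜 n)
    (hM : ∀ (j : Fin n) (a : MassiveDirac.Cl 𝕜 n),
      M (MassiveDirac.e 𝕜 j * a) = MassiveDirac.e 𝕜 j * M a)
    (Ω : Set (EuclideanSpace ℝ (Fin (n + 1)))) (hΩ : IsOpen Ω)
    (f : EuclideanSpace ℝ (Fin (n + 1)) → MassiveDirac.Cl 𝕜 n)
    (hf : MassiveDirac.IsSolution M Ω f)
    (x : EuclideanSpace ℝ (Fin (n + 1))) (R : ℝ) (hR : 0 < R) (hball : Metric.ball x R ⊆ Ω) :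
    MeasureTheory.IntegrableOn (fun y => NormedSpace.exp ((-(y 0)) • M) (f y)) (Metric.ball x R) ∧
      f x = NormedSpace.exp (x 0 • M)
        ((((n : ℝ) + 1) * Real.Gamma (((n : ℝ) + 1) / 2) /
            (2 * R ^ (n + 1) * Real.pi ^ (((n : ℝ) + 1) / 2))) •
          ∫ y in Metric.ball x R, NormedSpace.exp ((-(y 0)) • M) (f y)) := by
  have : CompleteSpace (MassiveDirac.Cl 𝕜 n) := FiniteDimensional.complete ℝ _
  -- Continuity up to the boundary enters only here: it makes the integrand continuous on a compact
  -- ball, hence integrable.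
  have hcl : closedBall x R ⊆ closure Ω := by
    rw [← closure_ball x hR.ne']
    exact closure_mono hball
  have hexp : Continuous fun y : EuclideanSpace ℝ (Fin (n + 1)) =>
      NormedSpace.exp ((-(y 0)) • M) :=
    (continuous_iff_continuousAt.2 fun t : ℝ =>
      (hasDerivAt_exp_smul_const M t).continuousAt).comp (by fun_prop)
  have hint : IntegrableOn (fun y => NormedSpace.exp ((-(y 0)) • M) (f y)) (ball x R) :=
    ((hexp.continuousOn.clm_apply (hf.continuousOn_closure.mono hcl)).integrableOn_compact
      (isCompact_closedBall x R)).mono_set ball_subset_closedBall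
  have hmp := measurePreserving_add_right (volume : Measure (EuclideanSpace ℝ (Fin (n + 1)))) x
  have hemb := measurableEmbedding_addRight x
  have hpre : (fun y => y + x) ⁻¹' ball x R = ball 0 R := by
    ext y; simp
  have hmem : ∀ y ∈ ball (0 : EuclideanSpace ℝ (Fin (n + 1))) R, y + x ∈ Ω := fun y hy =>
    hball (by rwa [← hpre] at hy)
  have key := MassiveDirac.setIntegral_ball_zero_eq
    (MassiveDirac.paravector_operators_anticomm (𝕜 := 𝕜) (n := n)) hR
    (g := fun y => NormedSpace.exp ((-((y + x) 0)) • M) (f (y + x)))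
    (by
      rw [← hpre]
      exact (hmp.integrableOn_comp_preimage hemb).2 hint)
    (fun y hy => (MassiveDirac.hasFDerivAt_exp_smul_apply M x y
      (hf.differentiableAt _ (hmem y hy))).differentiableAt)
    (fun y hy => MassiveDirac.dirac_exp_smul_apply_eq_zero hM hf x y (hmem y hy))
  rw [← hpre, hmp.setIntegral_preimage_emb hemb
    (fun y => NormedSpace.exp ((-(y 0)) • M) (f y)), hpre] at key
  have hvol : volume.real (ball (0 : EuclideanSpace ℝ (Fin (n + 1))) R) ≠ 0 :=
    (ENNReal.toReal_pos (measure_ball_pos _ _ hR).ne' measure_ball_lt_top.ne).ne'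
  refine ⟨hint, ?_⟩
  rw [key, MassiveDirac.volume_real_ball_inv 0 hR, inv_smul_smul₀ hvol, zero_add]
  have : NormedSpace.exp (x 0 • M) * NormedSpace.exp ((-(x 0)) • M) = 1 := by
    let _ : NormedAlgebra ℚ (MassiveDirac.Cl 𝕜 n →L[ℝ] MassiveDirac.Cl 𝕜 n) :=
      NormedAlgebra.restrictScalars ℚ ℝ _
    rw [← NormedSpace.exp_add_of_commute (((Commute.refl M).smul_left _).smul_right _),
      ← add_smul, add_neg_cancel, zero_smul, NormedSpace.exp_zero]
  exact (DFunLike.congr_fun this (f x)).symm
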